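/- Let $\sigma$ be the morphism on words over $\{0,1,2\}$ defined by $\sigma(0)=01$, $\sigma(1)=02$, $\sigma(2)=0$, and let $\mathbf t=\sigma^{\omega}(0)=t_0t_1t_2\cdots=0102010\cdots$ be the Tribonacci word, that is, the infinite word having every $\sigma^j(0)$, $j\ge 0$, as a prefix. Let $T_{-1}=1$, $T_0=1$, $T_1=2$, $T_2=4$ and $T_k=T_{k-1}+T_{k-2}+T_{k-3}$ for $k\ge 3$. For $n\in\mathbb N$, the initial non-repetitive complexity of $\mathbf t$ is $$\mathrm{nsc}_{\mathbf t}(n)=\max\{m\in\mathbb N : t_i\cdots t_{i+n-1}\ne t_j\cdots t_{j+n-1}\text{ for all } i,j \text{ with } 0\le i<j\le m-1\}.$$ Theorem. If $k\ge 1$ and $n$ are integers with $$\frac{T_k+T_{k-2}-3}{2}<n\le\frac{T_{k+1}+T_{k-1}-3}{2},$$ then $\mathrm{nsc}_{\mathbf t}(n)=T_k$. -/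

import Mathlib

/-- The length-`n` factor `x_i x_{i+1} ⋯ x_{i+n-1}` of the infinite word `x`. -/
def wordFactor {α : Type*} (x : ℕ → α) (i n : ℕ) : List α :=
  List.ofFn fun l : Fin n => x (i + l)

/-- The set of all `m` such that the length-`n` factors of `x` starting at the positions
`0, 1, …, m - 1` are pairwise distinct. -/
def nonrepetitiveLengths {α : Type*} (x : ℕ → α) (n : ℕ) : Set ℕ :=
  {m | ∀ i j : ℕ, i < j → j < m → wordFactor x i n ≠ wordFactor x j n}

/-- The initial non-repetitive complexity function of the infinite word `x`: the maximum of
`nonrepetitiveLengths x n` (an actual maximum over a finite alphabet, see `isGreatest_nsc`). -/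
noncomputable def nsc {α : Type*} (x : ℕ → α) (n : ℕ) : ℕ :=
  sSup (nonrepetitiveLengths x n)

theorem isGreatest_nsc {α : Type*} [Finite α] (x : ℕ → α) (n : ℕ) :
    IsGreatest (nonrepetitiveLengths x n) (nsc x n) := by
  have hne : (nonrepetitiveLengths x n).Nonempty := ⟨0, fun i j _ h => by omega⟩
  have hb : BddAbove (nonrepetitiveLengths x n) := by
    refine ⟨Nat.card (Fin n → α), fun m hm => ?_⟩
    have hinj : Function.Injective
        (fun (i : Fin m) (l : Fin n) => x ((i : ℕ) + (l : ℕ))) := by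
      intro i j hij
      have hw : wordFactor x i n = wordFactor x j n := congrArg List.ofFn hij
      rcases lt_trichotomy (i : ℕ) (j : ℕ) with h | h | h
      · exact absurd hw (hm i j h j.2)
      · exact Fin.ext h
      · exact absurd hw.symm (hm j i h i.2)
    simpa using Nat.card_le_card_of_injective _ hinj
  exact ⟨Nat.sSup_mem hne hb, fun m hm => le_csSup hb hm⟩

/-- The Tribonacci morphism on letters: `0 ↦ 01`, `1 ↦ 02`, `2 ↦ 0`. -/
def tribLetter : Fin 3 → List (Fin 3)
  | 0 => [0, 1]
  | 1 => [0, 2]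
  | 2 => [0]

/-- The Tribonacci morphism on finite words. -/
def tribMorphism (w : List (Fin 3)) : List (Fin 3) :=
  w.flatMap tribLetter

/-- The finite words obtained by applying the Tribonacci morphism `k` times to the word `0`. -/
def tribPrefix (k : ℕ) : List (Fin 3) :=
  tribMorphism^[k] [0]

theorem tribPrefix_succ (k : ℕ) : tribPrefix (k + 1) = tribMorphism (tribPrefix k) :=
  Function.iterate_succ_apply' _ _ _

theorem tribMorphism_isPrefix {u v : List (Fin 3)} (h : u <+: v) :
    tribMorphism u <+: tribMorphism v := by
  obtain ⟨s, rfl⟩ := h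
  exact ⟨tribMorphism s, by simp [tribMorphism]⟩

theorem tribPrefix_isPrefix_succ (k : ℕ) : tribPrefix k <+: tribPrefix (k + 1) := by
  induction k with
  | zero => exact ⟨[1], rfl⟩
  | succ k ih =>
    rw [tribPrefix_succ k, tribPrefix_succ (k + 1)]
    exact tribMorphism_isPrefix ih

theorem tribPrefix_isPrefix {k l : ℕ} (h : k ≤ l) : tribPrefix k <+: tribPrefix l := by
  induction l, h using Nat.le_induction with
  | base => exact List.prefix_rfl
  | succ l _ ih => exact ih.trans (tribPrefix_isPrefix_succ l)

theorem length_le_length_tribMorphism (w : List (Fin 3)) :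
    w.length ≤ (tribMorphism w).length := by
  induction w with
  | nil => simp
  | cons a w ih =>
    have ha : 1 ≤ (tribLetter a).length := by fin_cases a <;> simp [tribLetter]
    have hs : tribMorphism (a :: w) = tribLetter a ++ tribMorphism w := by simp [tribMorphism]
    rw [hs, List.length_append, List.length_cons]
    omega

theorem lt_length_tribPrefix (k : ℕ) : k < (tribPrefix k).length := by
  have key : ∀ k, k < (tribPrefix k).length ∧ ∃ w, tribPrefix k = 0 :: w := by
    intro k
    induction k with
    | zero => exact ⟨by simp [tribPrefix], [], rfl⟩
    | succ k ih =>
      obtain ⟨h, w, hw⟩ := ih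
      have hs : tribPrefix (k + 1) = 0 :: 1 :: tribMorphism w := by
        rw [tribPrefix_succ, hw]; rfl
      refine ⟨?_, _, hs⟩
      have hl := length_le_length_tribMorphism w
      rw [hw, List.length_cons] at h
      rw [hs, List.length_cons, List.length_cons]
      omega
  exact (key k).1

/-- The Tribonacci word: the infinite word all of whose prefixes of the form `tribPrefix k`
agree with it (see `tribWord_eq`). -/
def tribWord (i : ℕ) : Fin 3 :=
  (tribPrefix i)[i]'(lt_length_tribPrefix i)

/-- Every `tribPrefix k` is a prefix of `tribWord`. -/
theorem tribWord_eq (k i : ℕ) (h : i < (tribPrefix k).length) :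
    tribWord i = (tribPrefix k)[i] := by
  rcases le_total i k with hik | hik
  · exact (tribPrefix_isPrefix hik).getElem (lt_length_tribPrefix i)
  · exact ((tribPrefix_isPrefix hik).getElem h).symm

/-- The Tribonacci numbers `T_0 = 1`, `T_1 = 2`, `T_2 = 4`,
`T_k = T_{k-1} + T_{k-2} + T_{k-3}` for `k ≥ 3`. -/
def tribNat : ℕ → ℕ
  | 0 => 1
  | 1 => 2
  | 2 => 4
  | k + 3 => tribNat (k + 2) + tribNat (k + 1) + tribNat k

/-- The Tribonacci numbers with the additional convention `T_{-1} = 1`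
(the indices below `-1` are irrelevant). -/
def tribNumber : ℤ → ℕ
  | Int.ofNat k => tribNat k
  | Int.negSucc _ => 1

/-!
Write `t` for the Tribonacci word and `σ` for the Tribonacci morphism, so that `t = σ(t)`, and let
`M_k = (T_{k+1} + T_{k-1} - 3) / 2`; these are the lengths of the palindromic prefixes of `t`, and
`M_{k+1} = M_k + T_k`. The claim is that `nsc(n) = T_k` for `M_{k-1} < n ≤ M_k`.

Everything is carried through `σ`. Let `f(p)` be the length of `σ(t_0 ⋯ t_{p-1})`, the position
in `t` at which the image of `t_p` starts. The letter `0` occurs in `t` exactly at the positions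
`f(p)`, and the letter after it determines `t_p`. Consequently, if the longest common
prefix of the suffixes of `t` starting at `p` and `q` is `u`, then for those starting at `f(p)` and
`f(q)` it is `σ(u)0`.

* Upper bound: the prefix of length `M_k` occurs again at position `T_k`
  (`tribWord_tribNat_add`). The step from `k` to `k + 1` applies `σ`, because `f(T_k) = T_{k+1}` and
  `f(M_k) + 1 = M_{k+1}`.
* Lower bound: for `i < j < T_{k+1}`, the longest common prefix of the suffixes starting at `i` and
  `j` is a suffix of the prefix of length `M_k` (`exists_common_prefix`), so it has length at most
  `M_k` and factors of length `M_k + 1` differ. Recording that the common prefix is a suffix of this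
  word, and not only a bound on its length, is what makes the induction work: the
  length of `σ(u)` is not determined by that of `u`, but if `u` is a suffix of `p`, then `σ(u)0` is
  a suffix of `σ(p)0`.
-/

/-! ### The morphism acting on positions -/

theorem eq_map_tribWord_of_isPrefix {w : List (Fin 3)} {k : ℕ} (h : w <+: tribPrefix k) :
    w = (List.range w.length).map tribWord := by
  refine List.ext_getElem (by simp) fun i h₁ _ => ?_
  have h₂ : i < (tribPrefix k).length := h₁.trans_le h.length_le
  rw [List.getElem_map, List.getElem_range, tribWord_eq k i h₂]
  exact h.getElem h₁

theorem map_tribWord_isPrefix {p k : ℕ} (h : p ≤ (tribPrefix k).length) :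
    (List.range p).map tribWord <+: tribPrefix k := by
  have e := eq_map_tribWord_of_isPrefix (List.take_prefix p (tribPrefix k))
  rw [List.length_take, min_eq_left h] at e
  rw [← e]
  exact List.take_prefix p _

/-- The length of the image under the Tribonacci morphism of the prefix of length `p` of the
Tribonacci word, that is, the position at which the image of the letter at position `p` starts. -/
def tribImagePos (p : ℕ) : ℕ :=
  (tribMorphism ((List.range p).map tribWord)).length

theorem tribImagePos_zero : tribImagePos 0 = 0 := rfl

theorem tribImagePos_succ (p : ℕ) :
    tribImagePos (p + 1) = tribImagePos p + (tribLetter (tribWord p)).length := by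
  simp [tribImagePos, tribMorphism, List.range_succ]

theorem tribMorphism_map_tribWord (p : ℕ) :
    tribMorphism ((List.range p).map tribWord) = (List.range (tribImagePos p)).map tribWord := by
  have h := tribMorphism_isPrefix (map_tribWord_isPrefix (lt_length_tribPrefix p).le)
  rw [← tribPrefix_succ] at h
  exact eq_map_tribWord_of_isPrefix h

/-- The Tribonacci word is fixed by the morphism, read at a single letter. -/
theorem tribWord_tribImagePos_add (p l : ℕ) (h : l < (tribLetter (tribWord p)).length) :
    tribWord (tribImagePos p + l) = (tribLetter (tribWord p))[l] := by
  have e := tribMorphism_map_tribWord (p + 1)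
  have e' : tribMorphism ((List.range (p + 1)).map tribWord)
      = (List.range (tribImagePos p)).map tribWord ++ tribLetter (tribWord p) := by
    rw [← tribMorphism_map_tribWord p]
    simp [tribMorphism, List.range_succ]
  rw [e', tribImagePos_succ] at e
  have := congrArg (fun w : List (Fin 3) => w[tribImagePos p + l]?) e
  simp only [List.getElem?_append, List.length_map, List.length_range, List.getElem?_map] at this
  rw [if_neg (by omega), Nat.add_sub_cancel_left, List.getElem?_eq_getElem h,
    List.getElem?_range (by omega)] at this
  simpa using this.symm

theorem length_tribLetter (a : Fin 3) : (tribLetter a).length = if a = 2 then 1 else 2 := by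
  fin_cases a <;> rfl

theorem tribWord_tribImagePos (p : ℕ) : tribWord (tribImagePos p) = 0 := by
  have h := tribWord_tribImagePos_add p 0 (by rw [length_tribLetter]; split_ifs <;> omega)
  rw [Nat.add_zero] at h
  rw [h]
  generalize tribWord p = a
  fin_cases a <;> rfl

/-- The letter after the start of an image block determines the preimage letter: a block `0` coming
from the letter `2` is followed by the `0` of the next block. -/
theorem tribWord_tribImagePos_add_one (p : ℕ) :
    tribWord (tribImagePos p + 1) = tribWord p + 1 := by
  by_cases h : tribWord p = 2
  · have h' := tribImagePos_succ p
    rw [length_tribLetter, if_pos h] at h'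
    rw [← h', tribWord_tribImagePos, h]
    rfl
  · rw [tribWord_tribImagePos_add p 1 (by rw [length_tribLetter, if_neg h]; omega)]
    revert h
    generalize tribWord p = a
    fin_cases a <;> decide

theorem tribImagePos_lt_succ (p : ℕ) : tribImagePos p < tribImagePos (p + 1) := by
  rw [tribImagePos_succ, length_tribLetter]
  split_ifs <;> omega

theorem tribImagePos_strictMono : StrictMono tribImagePos :=
  strictMono_nat_of_lt_succ tribImagePos_lt_succ

theorem tribImagePos_succ_le (p : ℕ) : tribImagePos (p + 1) ≤ tribImagePos p + 2 := by
  rw [tribImagePos_succ, length_tribLetter]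
  split_ifs <;> omega

theorem exists_eq_tribImagePos_or (i : ℕ) :
    ∃ p, i = tribImagePos p ∨ i = tribImagePos p + 1 ∧ tribWord i ≠ 0 := by
  induction i with
  | zero => exact ⟨0, Or.inl rfl⟩
  | succ i ih =>
    obtain ⟨p, rfl | ⟨rfl, h⟩⟩ := ih
    · by_cases h : tribWord p = 2
      · exact ⟨p + 1, Or.inl (by rw [tribImagePos_succ, length_tribLetter, if_pos h])⟩
      · refine ⟨p, Or.inr ⟨rfl, ?_⟩⟩
        rw [tribWord_tribImagePos_add_one]
        revert h
        generalize tribWord p = a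
        fin_cases a <;> decide
    · refine ⟨p + 1, Or.inl ?_⟩
      have h2 : tribWord p ≠ 2 := by
        intro h2
        apply h
        rw [tribWord_tribImagePos_add_one, h2]
        rfl
      rw [tribImagePos_succ, length_tribLetter, if_neg h2]

theorem exists_eq_tribImagePos {i : ℕ} (h : tribWord i = 0) : ∃ p, i = tribImagePos p := by
  obtain ⟨p, hp | ⟨_, hp⟩⟩ := exists_eq_tribImagePos_or i
  · exact ⟨p, hp⟩
  · exact absurd h hp

theorem exists_eq_tribImagePos_add_one {i : ℕ} (h : tribWord i ≠ 0) :
    ∃ p, i = tribImagePos p + 1 := by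
  obtain ⟨p, hp | ⟨hp, _⟩⟩ := exists_eq_tribImagePos_or i
  · rw [hp] at h
    exact absurd (tribWord_tribImagePos p) h
  · exact ⟨p, hp⟩

theorem tribImagePos_add_of_eq {p q r : ℕ}
    (h : ∀ s < r, tribWord (p + s) = tribWord (q + s)) :
    tribImagePos (p + r) + tribImagePos q = tribImagePos (q + r) + tribImagePos p := by
  induction r with
  | zero => rw [Nat.add_zero, Nat.add_zero, Nat.add_comm]
  | succ r ih =>
    have ih := ih fun s hs => h s (by omega)
    rw [← Nat.add_assoc, ← Nat.add_assoc, tribImagePos_succ, tribImagePos_succ, h r (by omega)]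
    omega

/-- If `u` occurs in the Tribonacci word at `p` and `q`, then `σ(u)0` occurs at the positions where
the images of `p` and `q` start. -/
theorem tribWord_tribImagePos_add_eq {p q r : ℕ}
    (h : ∀ s < r, tribWord (p + s) = tribWord (q + s)) {x : ℕ}
    (hx : tribImagePos p + x ≤ tribImagePos (p + r)) :
    tribWord (tribImagePos p + x) = tribWord (tribImagePos q + x) := by
  induction r with
  | zero =>
    obtain rfl : x = 0 := by
      rw [Nat.add_zero] at hx
      omega
    simp only [Nat.add_zero, tribWord_tribImagePos]
  | succ r ih =>
    have ih := ih fun s hs => h s (by omega)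
    have hr := tribImagePos_add_of_eq fun s (hs : s < r) => h s (by omega)
    have hr' := tribImagePos_add_of_eq h
    have hle := tribImagePos_succ_le (p + r)
    rcases Nat.lt_or_ge (tribImagePos (p + r)) (tribImagePos p + x) with hlt | hge
    · rcases Nat.lt_or_ge (tribImagePos p + x) (tribImagePos (p + (r + 1))) with hlt' | hge'
      · rw [← Nat.add_assoc] at hlt'
        rw [show tribImagePos p + x = tribImagePos (p + r) + 1 by omega,
          show tribImagePos q + x = tribImagePos (q + r) + 1 by omega,
          tribWord_tribImagePos_add_one, tribWord_tribImagePos_add_one, h r (by omega)]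
      · rw [show tribImagePos p + x = tribImagePos (p + (r + 1)) by omega,
          show tribImagePos q + x = tribImagePos (q + (r + 1)) by omega,
          tribWord_tribImagePos, tribWord_tribImagePos]
    · exact ih hge

/-! ### Tribonacci numbers and palindromic prefix lengths -/

theorem tribPrefix_add_three (k : ℕ) :
    tribPrefix (k + 3) = tribPrefix (k + 2) ++ tribPrefix (k + 1) ++ tribPrefix k := by
  induction k with
  | zero => rfl
  | succ k ih =>
    rw [tribPrefix_succ (k + 3), ih]
    rw [tribMorphism, List.flatMap_append, List.flatMap_append, ← tribMorphism, ← tribMorphism,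
      ← tribMorphism, ← tribPrefix_succ, ← tribPrefix_succ, ← tribPrefix_succ, ← ih]

theorem length_tribPrefix (k : ℕ) : (tribPrefix k).length = tribNat k := by
  induction k using tribNat.induct with
  | case1 | case2 | case3 => rfl
  | case4 k ih₁ ih₂ ih₃ =>
    rw [tribPrefix_add_three, List.length_append, List.length_append, ih₁, ih₂, ih₃, tribNat]

theorem tribImagePos_tribNat (k : ℕ) : tribImagePos (tribNat k) = tribNat (k + 1) := by
  rw [← length_tribPrefix, ← length_tribPrefix, tribPrefix_succ, tribImagePos,
    ← eq_map_tribWord_of_isPrefix List.prefix_rfl]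

/-- The length `(T_{k+1} + T_{k-1} - 3) / 2` of a palindromic prefix of the Tribonacci word, defined
as a sum of Tribonacci numbers (see `two_mul_tribPalLength`). -/
def tribPalLength (k : ℕ) : ℕ :=
  ∑ i ∈ Finset.range k, tribNat i

theorem tribPalLength_succ (k : ℕ) : tribPalLength (k + 1) = tribPalLength k + tribNat k :=
  Finset.sum_range_succ _ _

theorem two_mul_tribPalLength (k : ℕ) :
    2 * tribPalLength (k + 1) + 3 = tribNat (k + 2) + tribNat k := by
  induction k with
  | zero => rfl
  | succ k ih =>
    rw [tribPalLength_succ, tribNat]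
    omega

/-! ### Repetition of the palindromic prefixes -/

/-- The prefix of length `tribPalLength k` occurs again at position `T_k`, and `σ` followed by
appending `0` maps each of these prefixes to the next one. The two facts are proved together, since
the image length of the prefix is computed by splitting off its period `T_k`. -/
theorem tribWord_tribNat_add_and_tribImagePos (k : ℕ) :
    (∀ x < tribPalLength k, tribWord (0 + x) = tribWord (tribNat k + x)) ∧
      tribImagePos (tribPalLength k) + 1 = tribPalLength (k + 1) := by
  induction k with
  | zero => exact ⟨fun x hx => absurd hx (Nat.not_lt_zero x), rfl⟩
  | succ k ih =>
    obtain ⟨hU, hC⟩ := ih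
    refine ⟨fun x hx => ?_, ?_⟩
    · have h := tribWord_tribImagePos_add_eq hU (x := x)
        (by rw [tribImagePos_zero, Nat.zero_add, Nat.zero_add]; omega)
      rwa [tribImagePos_zero, tribImagePos_tribNat] at h
    · have h := tribImagePos_add_of_eq hU
      rw [tribImagePos_tribNat, tribImagePos_zero, Nat.zero_add] at h
      rw [Nat.add_comm (tribNat k), ← tribPalLength_succ] at h
      have h' := tribPalLength_succ (k + 1)
      omega

theorem tribWord_tribNat_add {k x : ℕ} (hx : x < tribPalLength k) :
    tribWord (tribNat k + x) = tribWord x := by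
  simpa using ((tribWord_tribNat_add_and_tribImagePos k).1 x hx).symm

theorem tribImagePos_tribPalLength (k : ℕ) :
    tribImagePos (tribPalLength k) + 1 = tribPalLength (k + 1) :=
  (tribWord_tribNat_add_and_tribImagePos k).2

/-! ### Longest common prefixes -/

/-- The longest common prefix of the suffixes of the Tribonacci word starting at two positions below
`T_{k+1}` is a suffix, of length `r`, of the prefix of length `tribPalLength k`. -/
theorem exists_common_prefix (k : ℕ) {i j : ℕ} (hij : i < j) (hj : j < tribNat (k + 1)) :
    ∃ r ≤ tribPalLength k, tribWord (i + r) ≠ tribWord (j + r) ∧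
      (∀ s < r, tribWord (i + s) = tribWord (j + s)) ∧
      ∀ s < r, tribWord (i + s) = tribWord (tribPalLength k - r + s) := by
  induction k generalizing i j with
  | zero =>
    have hj' : j < 2 := hj
    obtain ⟨rfl, rfl⟩ : i = 0 ∧ j = 1 := by omega
    exact ⟨0, le_rfl, by decide, by simp, by simp⟩
  | succ k ih =>
    have block : ∀ p q : ℕ, tribImagePos p < tribImagePos q →
        tribImagePos q < tribNat (k + 1 + 1) →
        ∃ r ≤ tribPalLength (k + 1), 0 < r ∧
          tribWord (tribImagePos p + r) ≠ tribWord (tribImagePos q + r) ∧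
          (∀ s < r, tribWord (tribImagePos p + s) = tribWord (tribImagePos q + s)) ∧
          ∀ s < r, tribWord (tribImagePos p + s) = tribWord (tribPalLength (k + 1) - r + s) := by
      intro p q hpq hq
      rw [← tribImagePos_tribNat] at hq
      obtain ⟨r, hr, hne, heq, hpal⟩ := ih (tribImagePos_strictMono.lt_iff_lt.1 hpq)
        (tribImagePos_strictMono.lt_iff_lt.1 hq)
      have e₁ := tribImagePos_add_of_eq heq
      have e₂ := tribImagePos_add_of_eq hpal
      have hp : tribImagePos p ≤ tribImagePos (p + r) :=
        tribImagePos_strictMono.monotone (by omega)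
      have hC := tribImagePos_tribPalLength k
      rw [Nat.sub_add_cancel hr] at e₂
      refine ⟨tribImagePos (p + r) - tribImagePos p + 1, by omega, by omega, ?_, ?_, ?_⟩
      · rw [show tribImagePos p + (tribImagePos (p + r) - tribImagePos p + 1)
            = tribImagePos (p + r) + 1 by omega,
          show tribImagePos q + (tribImagePos (p + r) - tribImagePos p + 1)
            = tribImagePos (q + r) + 1 by omega,
          tribWord_tribImagePos_add_one, tribWord_tribImagePos_add_one]
        exact fun h => hne (add_right_cancel h)
      · exact fun s hs => tribWord_tribImagePos_add_eq heq (by omega)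
      · intro s hs
        rw [show tribPalLength (k + 1) - (tribImagePos (p + r) - tribImagePos p + 1)
          = tribImagePos (tribPalLength k - r) by omega]
        exact tribWord_tribImagePos_add_eq hpal (by omega)
    by_cases hne : tribWord i = tribWord j
    · by_cases h0 : tribWord i = 0
      · obtain ⟨p, rfl⟩ := exists_eq_tribImagePos h0
        obtain ⟨q, rfl⟩ := exists_eq_tribImagePos (hne ▸ h0)
        obtain ⟨r, hr, _, h⟩ := block p q hij hj
        exact ⟨r, hr, h⟩
      · -- Both positions are preceded by `0`, so the common prefix is the tail of the one found
        -- one position earlier.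
        obtain ⟨p, rfl⟩ := exists_eq_tribImagePos_add_one h0
        obtain ⟨q, rfl⟩ := exists_eq_tribImagePos_add_one (hne ▸ h0)
        obtain ⟨r, hr, hpos, h₁, h₂, h₃⟩ := block p q (by omega) (by omega)
        obtain ⟨r, rfl⟩ : ∃ r', r = r' + 1 := ⟨r - 1, by omega⟩
        refine ⟨r, by omega, ?_, fun s hs => ?_, fun s hs => ?_⟩
        · rwa [Nat.add_assoc, Nat.add_assoc, Nat.add_comm 1 r]
        · rw [Nat.add_assoc, Nat.add_assoc, Nat.add_comm 1 s]
          exact h₂ (s + 1) (by omega)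
        · rw [Nat.add_assoc, Nat.add_comm 1 s, h₃ (s + 1) (by omega)]
          congr 1
          omega
    · exact ⟨0, Nat.zero_le _, hne, by simp, by simp⟩

/-! ### The initial non-repetitive complexity -/

theorem wordFactor_eq_iff {α : Type*} {x : ℕ → α} {i j n : ℕ} :
    wordFactor x i n = wordFactor x j n ↔ ∀ l < n, x (i + l) = x (j + l) := by
  rw [wordFactor, wordFactor, List.ofFn_inj, funext_iff, Fin.forall_iff]

theorem tribNat_pos (k : ℕ) : 0 < tribNat k := by
  rw [← length_tribPrefix]
  exact (Nat.zero_le k).trans_lt (lt_length_tribPrefix k)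

theorem nsc_tribWord_eq {k n : ℕ} (hlower : tribPalLength k < n)
    (hupper : n ≤ tribPalLength (k + 1)) : nsc tribWord n = tribNat (k + 1) := by
  refine (isGreatest_nsc tribWord n).unique ⟨fun i j hij hj h => ?_, fun m hm => ?_⟩
  · obtain ⟨r, hr, hne, _⟩ := exists_common_prefix k hij hj
    exact hne (wordFactor_eq_iff.1 h r (by omega))
  · by_contra! hlt
    refine hm 0 (tribNat (k + 1)) (tribNat_pos _) hlt (wordFactor_eq_iff.2 fun l hl => ?_)
    rw [tribWord_tribNat_add (by omega), Nat.zero_add]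

/-- The case `k = 0` is separate because `T_{-1}` is a convention outside the range of `tribNat`. -/
theorem two_mul_tribPalLength_eq_tribNumber (k : ℕ) :
    2 * tribPalLength k + 3 = tribNumber ((k : ℤ) + 1) + tribNumber ((k : ℤ) - 1) := by
  cases k with
  | zero => rfl
  | succ k =>
    rw [two_mul_tribPalLength, show ((k + 1 : ℕ) : ℤ) + 1 = ((k + 2 : ℕ) : ℤ) by push_cast; ring,
      show ((k + 1 : ℕ) : ℤ) - 1 = (k : ℤ) by push_cast; ring]
    rfl

theorem mainTheorem3 (k n : ℕ) (hk : 1 ≤ k)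
    (hlower : ((tribNumber k : ℚ) + (tribNumber ((k : ℤ) - 2) : ℚ) - 3) / 2 < (n : ℚ))
    (hupper : (n : ℚ) ≤
      ((tribNumber ((k : ℤ) + 1) : ℚ) + (tribNumber ((k : ℤ) - 1) : ℚ) - 3) / 2) :
    nsc tribWord n = tribNumber k := by
  obtain ⟨k, rfl⟩ : ∃ k', k = k' + 1 := ⟨k - 1, by omega⟩
  have h₁ := two_mul_tribPalLength_eq_tribNumber k
  have h₂ := two_mul_tribPalLength_eq_tribNumber (k + 1)
  rw [show (k : ℤ) + 1 = ((k + 1 : ℕ) : ℤ) by push_cast; ring,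
    show (k : ℤ) - 1 = ((k + 1 : ℕ) : ℤ) - 2 by push_cast; ring] at h₁
  rw [← Nat.cast_add, ← h₁] at hlower
  rw [← Nat.cast_add, ← h₂] at hupper
  push_cast at hlower hupper
  refine nsc_tribWord_eq ?_ ?_
  · have : (tribPalLength k : ℚ) < n := by linarith
    exact_mod_cast this
  · have : (n : ℚ) ≤ tribPalLength (k + 1) := by linarith
    exact_mod_cast this
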